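/- Let $A\in\mathbb{C}^{n\times n}$, $B\in\mathbb{C}^{n\times m}$, $C\in\mathbb{C}^{p\times n}$, $D\in\mathbb{C}^{p\times m}$, where $A$ is Schur stable, i.e. its spectral radius satisfies $\rho(A)<1$. Let $\mu_\infty$ be the optimal value of the worst-case disturbance problem $$\mu_\infty := \sup\Big\{ \|\mathbf z\|_2^2=\sum_{k=0}^\infty \|z_k\|_2^2 \;:\; x_0=0,\ x_{k+1}=Ax_k+Bw_k,\ z_k=Cx_k+Dw_k\ (k\ge 0),\ \mathbf w=(w_k)_{k\ge0}\in l_2,\ \|\mathbf w\|_2^2=1\Big\}$$ (with value $0$ in the degenerate case $m=0$, where no $\mathbf w$ is admissible). Suppose that $(A,B)$ is controllable, i.e. the matrix $[\,B\ \ AB\ \ \cdots\ \ A^{n-1}B\,]$ has rank $n$. Then $\mu_\infty\le 1$ if and only if there exists a Hermitian matrix $P\in\mathbb{C}^{n\times n}$ such that $$\begin{bmatrix} A^*PA-P & A^*PB\\ B^*PA & B^*PB\end{bmatrix}+\begin{bmatrix} C^*C & C^*D\\ D^*C & D^*D-I_m\end{bmatrix}\preceq 0 ,$$ where $M\preceq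 0$ means that $-M$ is Hermitian positive semidefinite. -/

import Mathlib

open scoped ENNReal Matrix ComplexOrder

noncomputable section

namespace KYP

/-- The space of square summable sequences `w₀, w₁, w₂, …` of vectors in `ℂᵐ`, where `ℂᵐ` carries
the Euclidean norm. -/
abbrev Signal (m : ℕ) : Type := lp (fun _ : ℕ => EuclideanSpace ℂ (Fin m)) 2

/-- The squared two-norm `∑ₖ ‖uₖ‖²` of a sequence in `ℂᵖ`, with values in `[0, ∞]`; it is finite
exactly for the square summable sequences. -/
def energy {p : ℕ} (u : ℕ → EuclideanSpace ℂ (Fin p)) : ℝ≥0∞ :=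
  ∑' k, ‖u k‖ₑ ^ 2

/-- The triple `(w, x, z)` satisfies `x₀ = 0`, `xₖ₊₁ = A xₖ + B wₖ` and `zₖ = C xₖ + D wₖ`. -/
structure IsTrajectory {n m p : ℕ} (A : Matrix (Fin n) (Fin n) ℂ) (B : Matrix (Fin n) (Fin m) ℂ)
    (C : Matrix (Fin p) (Fin n) ℂ) (D : Matrix (Fin p) (Fin m) ℂ) (w : Signal m)
    (x : ℕ → EuclideanSpace ℂ (Fin n)) (z : ℕ → EuclideanSpace ℂ (Fin p)) : Prop where
  initial : x 0 = 0
  state : ∀ k, x (k + 1) = WithLp.toLp 2 (A *ᵥ (x k).ofLp + B *ᵥ (w k).ofLp)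
  output : ∀ k, z k = WithLp.toLp 2 (C *ᵥ (x k).ofLp + D *ᵥ (w k).ofLp)

/-- The worst case output energy over all square summable disturbances of norm one. -/
def muInf {n m p : ℕ} (A : Matrix (Fin n) (Fin n) ℂ) (B : Matrix (Fin n) (Fin m) ℂ)
    (C : Matrix (Fin p) (Fin n) ℂ) (D : Matrix (Fin p) (Fin m) ℂ) : ℝ≥0∞ :=
  sSup {r | ∃ w x z, IsTrajectory A B C D w x z ∧ ‖w‖ ^ 2 = 1 ∧ r = energy z}

/-- The `n × nm` matrix `[B, AB, …, Aⁿ⁻¹B]`; its column `(k, j)` is the `j`-th column of `AᵏB`. -/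
def controllabilityMatrix {n m : ℕ} (A : Matrix (Fin n) (Fin n) ℂ) (B : Matrix (Fin n) (Fin m) ℂ) :
    Matrix (Fin n) (Fin n × Fin m) ℂ :=
  Matrix.of fun i kj => (A ^ (kj.1 : ℕ) * B) i kj.2

/-- `(A, B)` is controllable: the matrix `[B, AB, …, Aⁿ⁻¹B]` has rank `n`. -/
def IsControllable {n m : ℕ} (A : Matrix (Fin n) (Fin n) ℂ) (B : Matrix (Fin n) (Fin m) ℂ) : Prop :=
  (controllabilityMatrix A B).rank = n

/-- The matrix on the left of the KYP linear matrix inequality. -/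
def lmiMatrix {n m p : ℕ} (A : Matrix (Fin n) (Fin n) ℂ) (B : Matrix (Fin n) (Fin m) ℂ)
    (C : Matrix (Fin p) (Fin n) ℂ) (D : Matrix (Fin p) (Fin m) ℂ) (P : Matrix (Fin n) (Fin n) ℂ) :
    Matrix (Fin n ⊕ Fin m) (Fin n ⊕ Fin m) ℂ :=
  Matrix.fromBlocks (Aᴴ * P * A - P) (Aᴴ * P * B) (Bᴴ * P * A) (Bᴴ * P * B) +
    Matrix.fromBlocks (Cᴴ * C) (Cᴴ * D) (Dᴴ * C) (Dᴴ * D - 1)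

end KYP

end

/-!
The matrix inequality for a Hermitian `P` says that the quadratic form `S x = x* P x` satisfies the
dissipation inequality `‖C x + D u‖² - ‖u‖² + S (A x + B u) ≤ S x` for all `x` and `u`
(`KYP.neg_lmiMatrix_posSemidef_iff`). So the theorem is about the existence of a quadratic storage
function.

If such an `S` exists, summing the dissipation inequality along a trajectory from the origin bounds
the gain, that is the output energy minus the disturbance energy over a finite horizon, by `-S` of
the final state (`KYP.gain_le_of_dissipation`). Schur stability gives `S ≥ 0`: undisturbed
trajectories do not increase `S` and tend to `0` (`KYP.storage_nonneg_of_dissipation`). Hence no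
disturbance has positive gain from the origin, which gives `μ_∞ ≤ 1`.

Conversely, if `μ_∞ ≤ 1`, no finitely supported disturbance has positive gain from the origin
(`KYP.gain_nonpos_of_muInf_le_one`). Take for `S x` the available storage, the supremum of the gain
over all horizons and all disturbances, starting at `x`. It is finite because `x` is reachable: the
gain extracted from `x` cannot exceed the cost of driving the state from `0` to `x`
(`KYP.exists_gain_bound`). It satisfies the dissipation inequality by construction. It is a
Hermitian form because the gain is a quadratic form in the pair of initial state and disturbance,
and the parallelogram law survives the supremum over disturbances
(`KYP.finiteStorage_parallelogram`); a nonnegative homogeneous function with the parallelogram law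
comes from a Hermitian matrix (`KYP.exists_isHermitian_of_parallelogram`).
-/

open Filter Topology

namespace KYP

/-! ### Hermitian matrices from the parallelogram law -/

section Parallelogram

variable {V : Type*} [AddCommGroup V] [Module ℂ V] {S : V → ℝ}

/-- The polarization `S (x + y) - S (x - y)`; for a Hermitian form `S x = ⟪x, x⟫` it equals
`4 Re ⟪x, y⟫`. -/
def polarization (S : V → ℝ) (x y : V) : ℝ := S (x + y) - S (x - y)

lemma apply_neg_of_homogeneous (hS : ∀ (c : ℂ) x, S (c • x) = ‖c‖ ^ 2 * S x) (x : V) :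
    S (-x) = S x := by
  simpa using hS (-1) x

lemma polarization_symm (hS : ∀ (c : ℂ) x, S (c • x) = ‖c‖ ^ 2 * S x) (x y : V) :
    polarization S x y = polarization S y x := by
  rw [polarization, polarization, add_comm x y, ← neg_sub y x, apply_neg_of_homogeneous hS]

lemma polarization_I_smul_I_smul (hS : ∀ (c : ℂ) x, S (c • x) = ‖c‖ ^ 2 * S x) (x y : V) :
    polarization S (Complex.I • x) (Complex.I • y) = polarization S x y := by
  simp [polarization, ← smul_add, ← smul_sub, hS]

lemma polarization_neg_left (hS : ∀ (c : ℂ) x, S (c • x) = ‖c‖ ^ 2 * S x) (x y : V) :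
    polarization S (-x) y = -polarization S x y := by
  have h₁ : -x + y = -(x - y) := by abel
  have h₂ : -x - y = -(x + y) := by abel
  rw [polarization, polarization, h₁, h₂, apply_neg_of_homogeneous hS,
    apply_neg_of_homogeneous hS]
  ring

lemma polarization_zero_left (hS : ∀ (c : ℂ) x, S (c • x) = ‖c‖ ^ 2 * S x) (y : V) :
    polarization S 0 y = 0 := by
  simp [polarization, apply_neg_of_homogeneous hS]

lemma polarization_add_left (hS : ∀ (c : ℂ) x, S (c • x) = ‖c‖ ^ 2 * S x)
    (hpar : ∀ x y, S (x + y) + S (x - y) = 2 * (S x + S y)) (x x' y : V) :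
    polarization S (x + x') y = polarization S x y + polarization S x' y := by
  have key : ∀ u v : V,
      polarization S (u + v) y + polarization S (u - v) y = 2 * polarization S u y := by
    intro u v
    have h₁ := hpar (u + y) v
    have h₂ := hpar (u - y) v
    rw [show u + y + v = u + v + y by abel, show u + y - v = u - v + y by abel] at h₁
    rw [show u - y + v = u + v - y by abel, show u - y - v = u - v - y by abel] at h₂
    simp only [polarization]
    linarith
  have hdouble : ∀ u : V, polarization S ((2 : ℂ) • u) y = 2 * polarization S u y := by
    intro u
    have h := key u u
    rwa [sub_self, polarization_zero_left hS, add_zero, ← two_smul ℂ u] at h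
  have h := key ((2⁻¹ : ℂ) • (x + x')) ((2⁻¹ : ℂ) • (x - x'))
  rw [← smul_add, ← smul_sub, ← hdouble, smul_smul,
    show x + x' + (x - x') = (2 : ℂ) • x by rw [two_smul]; abel,
    show x + x' - (x - x') = (2 : ℂ) • x' by rw [two_smul]; abel, smul_smul, smul_smul] at h
  norm_num at h
  exact h.symm

/-- An additive function of a real variable that is bounded near `0` is linear; nonnegativity of
`S` provides the bound. -/
lemma polarization_real_smul_left (hS : ∀ (c : ℂ) x, S (c • x) = ‖c‖ ^ 2 * S x)
    (hpar : ∀ x y, S (x + y) + S (x - y) = 2 * (S x + S y)) (hnonneg : ∀ x, 0 ≤ S x)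
    (t : ℝ) (x y : V) :
    polarization S ((t : ℂ) • x) y = t * polarization S x y := by
  let f : ℝ →+ ℝ :=
    { toFun := fun t => polarization S ((t : ℂ) • x) y
      map_zero' := by simp [polarization_zero_left hS]
      map_add' := fun s t => by
        rw [Complex.ofReal_add, add_smul, polarization_add_left hS hpar] }
  have hf : Continuous f := by
    refine f.continuous_of_isBounded_nhds_zero (Metric.closedBall_mem_nhds (0 : ℝ) one_pos) ?_
    refine (Metric.isBounded_closedBall (x := (0 : ℝ)) (r := 2 * (S x + S y))).subset ?_
    rintro _ ⟨s, hs, rfl⟩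
    rw [mem_closedBall_zero_iff, Real.norm_eq_abs] at hs ⊢
    have h₁ := hpar ((s : ℂ) • x) y
    rw [hS, Complex.norm_real, Real.norm_eq_abs] at h₁
    have h₂ := hnonneg ((s : ℂ) • x + y)
    have h₃ := hnonneg ((s : ℂ) • x - y)
    have h₄ : |s| ^ 2 * S x ≤ S x :=
      mul_le_of_le_one_left (hnonneg x) (pow_le_one₀ (abs_nonneg s) hs)
    change |S ((s : ℂ) • x + y) - S ((s : ℂ) • x - y)| ≤ _
    rw [abs_le]
    constructor <;> linarith
  have h := (f.toRealLinearMap hf).map_smul t 1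
  simpa [f] using h

/-- The Hermitian form with diagonal `S`: its real part is a quarter of the polarization, and its
imaginary part is determined by linearity in the second variable. -/
noncomputable def hermitianForm (S : V → ℝ) (x y : V) : ℂ :=
  (1 / 4) * (polarization S y x - Complex.I * polarization S (Complex.I • y) x)

lemma hermitianForm_conj_symm (hS : ∀ (c : ℂ) x, S (c • x) = ‖c‖ ^ 2 * S x) (x y : V) :
    starRingEnd ℂ (hermitianForm S y x) = hermitianForm S x y := by
  have h : polarization S (Complex.I • y) x = -polarization S (Complex.I • x) y := by
    rw [← polarization_I_smul_I_smul hS, smul_smul, Complex.I_mul_I, neg_one_smul,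
      polarization_neg_left hS, polarization_symm hS]
  simp [hermitianForm, h, polarization_symm hS x y, map_ofNat]

lemma hermitianForm_add_right (hS : ∀ (c : ℂ) x, S (c • x) = ‖c‖ ^ 2 * S x)
    (hpar : ∀ x y, S (x + y) + S (x - y) = 2 * (S x + S y)) (x y y' : V) :
    hermitianForm S x (y + y') = hermitianForm S x y + hermitianForm S x y' := by
  simp only [hermitianForm, smul_add, polarization_add_left hS hpar]
  push_cast
  ring

lemma hermitianForm_smul_right (hS : ∀ (c : ℂ) x, S (c • x) = ‖c‖ ^ 2 * S x)
    (hpar : ∀ x y, S (x + y) + S (x - y) = 2 * (S x + S y)) (hnonneg : ∀ x, 0 ≤ S x)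
    (c : ℂ) (x y : V) :
    hermitianForm S x (c • y) = c * hermitianForm S x y := by
  have h : ∀ v : V, polarization S (c • v) x
      = c.re * polarization S v x + c.im * polarization S (Complex.I • v) x := by
    intro v
    conv_lhs => rw [← Complex.re_add_im c, add_smul, mul_smul, polarization_add_left hS hpar,
      polarization_real_smul_left hS hpar hnonneg, polarization_real_smul_left hS hpar hnonneg]
  have h' : polarization S (Complex.I • Complex.I • y) x = -polarization S y x := by
    rw [smul_smul, Complex.I_mul_I, neg_one_smul, polarization_neg_left hS]
  rw [hermitianForm, hermitianForm, smul_comm Complex.I c, h, h, h']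
  conv_rhs => rw [← Complex.re_add_im c]
  push_cast
  linear_combination (1 / 4 * (c.im : ℂ) * (polarization S (Complex.I • y) x : ℂ)) *
    Complex.I_mul_I

lemma hermitianForm_self (hS : ∀ (c : ℂ) x, S (c • x) = ‖c‖ ^ 2 * S x) (x : V) :
    hermitianForm S x x = S x := by
  have h₀ : S 0 = 0 := by simpa using hS 0 0
  have h₁ : polarization S x x = 4 * S x := by
    rw [polarization, ← two_smul ℂ x, hS, sub_self, h₀]
    norm_num
  -- `(I + 1) x` and `(I - 1) x` differ by the unimodular factor `I`.
  have h₂ : polarization S (Complex.I • x) x = 0 := by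
    have h : Complex.I • x + x = -(Complex.I • (Complex.I • x - x)) := by
      rw [smul_sub, smul_smul, Complex.I_mul_I, neg_one_smul]; abel
    rw [polarization, h, apply_neg_of_homogeneous hS, hS]
    simp
  rw [hermitianForm, h₁, h₂]
  push_cast
  ring

end Parallelogram

/-- A version of the Jordan–von Neumann theorem for nonnegative, possibly degenerate functions. -/
theorem exists_isHermitian_of_parallelogram {n : ℕ} {S : (Fin n → ℂ) → ℝ}
    (hS : ∀ (c : ℂ) x, S (c • x) = ‖c‖ ^ 2 * S x)
    (hpar : ∀ x y, S (x + y) + S (x - y) = 2 * (S x + S y)) (hnonneg : ∀ x, 0 ≤ S x) :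
    ∃ P : Matrix (Fin n) (Fin n) ℂ, P.IsHermitian ∧ ∀ x, star x ⬝ᵥ P *ᵥ x = S x := by
  let H : (Fin n → ℂ) →ₗ⋆[ℂ] (Fin n → ℂ) →ₗ[ℂ] ℂ :=
    LinearMap.mk₂'ₛₗ (starRingEnd ℂ) (RingHom.id ℂ) (hermitianForm S)
      (fun x x' y => by
        rw [← hermitianForm_conj_symm hS, hermitianForm_add_right hS hpar, map_add,
          hermitianForm_conj_symm hS, hermitianForm_conj_symm hS])
      (fun c x y => by
        rw [← hermitianForm_conj_symm hS, hermitianForm_smul_right hS hpar hnonneg, map_mul,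
          hermitianForm_conj_symm hS, smul_eq_mul])
      (fun x y y' => hermitianForm_add_right hS hpar x y y')
      (fun c x y => hermitianForm_smul_right hS hpar hnonneg c x y)
  refine ⟨LinearMap.toMatrixₛₗ₂' ℂ H, ?_, fun x => ?_⟩
  · ext i j
    rw [Matrix.conjTranspose_apply, LinearMap.toMatrixₛₗ₂'_apply, LinearMap.toMatrixₛₗ₂'_apply]
    exact hermitianForm_conj_symm hS _ _
  · have h : H x x = S x := hermitianForm_self hS x
    rw [← h]
    conv_rhs => rw [← Matrix.toLinearMapₛₗ₂'_toMatrix' (R := ℂ) (B := H)]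
    rw [Matrix.toLinearMapₛₗ₂'_apply]
    simp only [dotProduct, Matrix.mulVec, Finset.mul_sum, Pi.star_apply, smul_eq_mul,
      RingHom.id_apply, starRingEnd_apply]
    refine Finset.sum_congr rfl fun i _ => Finset.sum_congr rfl fun j _ => ?_
    ring

/-! ### Powers of a Schur stable matrix -/

/-- In a Banach algebra, Gelfand's formula makes the powers of an element of spectral radius less
than one decay geometrically. -/
theorem tendsto_pow_zero_of_spectralRadius_lt_one {R : Type*} [NormedRing R] [NormedAlgebra ℂ R]
    [CompleteSpace R] {a : R} (ha : spectralRadius ℂ a < 1) :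
    Tendsto (fun k : ℕ => a ^ k) atTop (𝓝 0) := by
  obtain ⟨r, har, hr⟩ := ENNReal.lt_iff_exists_nnreal_btwn.mp ha
  have hr1 : r < 1 := by exact_mod_cast hr
  have hev := (spectrum.pow_nnnorm_pow_one_div_tendsto_nhds_spectralRadius a).eventually_lt_const
    har
  rw [tendsto_zero_iff_norm_tendsto_zero]
  refine squeeze_zero' (Eventually.of_forall fun k => norm_nonneg _) ?_
    (tendsto_pow_atTop_nhds_zero_of_lt_one r.coe_nonneg (by exact_mod_cast hr1))
  filter_upwards [hev, eventually_gt_atTop 0] with k hk hk0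
  have hk0' : (k : ℝ) ≠ 0 := by positivity
  have h := ENNReal.rpow_le_rpow hk.le (Nat.cast_nonneg (α := ℝ) k)
  rw [← ENNReal.rpow_mul, one_div, inv_mul_cancel₀ hk0', ENNReal.rpow_one,
    ENNReal.rpow_natCast] at h
  exact_mod_cast h

theorem tendsto_pow_mulVec_zero {n : ℕ} {A : Matrix (Fin n) (Fin n) ℂ}
    (hA : spectralRadius ℂ A < 1) (x : Fin n → ℂ) :
    Tendsto (fun k : ℕ => (A ^ k) *ᵥ x) atTop (𝓝 0) := by
  have h : Tendsto (fun k : ℕ => A ^ k) atTop (𝓝 0) := by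
    let _ := Matrix.linftyOpNormedRing (n := Fin n) (α := ℂ)
    let _ := Matrix.linftyOpNormedAlgebra (R := ℂ) (n := Fin n) (α := ℂ)
    exact tendsto_pow_zero_of_spectralRadius_lt_one hA
  have hc : Continuous fun M : Matrix (Fin n) (Fin n) ℂ => M *ᵥ x :=
    continuous_id.matrix_mulVec continuous_const
  simpa [Function.comp_def] using (hc.tendsto 0).comp h

/-! ### Squared Euclidean norms -/

/-- The squared Euclidean norm of a coordinate vector. -/
noncomputable def sqNorm {k : ℕ} (v : Fin k → ℂ) : ℝ := ‖WithLp.toLp 2 v‖ ^ 2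

lemma sqNorm_nonneg {k : ℕ} (v : Fin k → ℂ) : 0 ≤ sqNorm v := sq_nonneg _

@[simp] lemma sqNorm_zero {k : ℕ} : sqNorm (0 : Fin k → ℂ) = 0 := by simp [sqNorm]

lemma sqNorm_smul {k : ℕ} (c : ℂ) (v : Fin k → ℂ) : sqNorm (c • v) = ‖c‖ ^ 2 * sqNorm v := by
  rw [sqNorm, sqNorm, WithLp.toLp_smul, norm_smul, mul_pow]

lemma sqNorm_parallelogram {k : ℕ} (u v : Fin k → ℂ) :
    sqNorm (u + v) + sqNorm (u - v) = 2 * (sqNorm u + sqNorm v) := by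
  have h := parallelogram_law_with_norm ℂ (WithLp.toLp 2 u) (WithLp.toLp 2 v)
  simpa only [sqNorm, WithLp.toLp_add, WithLp.toLp_sub, sq] using h

lemma ofReal_sqNorm {k : ℕ} (v : Fin k → ℂ) : (sqNorm v : ℂ) = star v ⬝ᵥ v := by
  have h := inner_self_eq_norm_sq_to_K (𝕜 := ℂ) (WithLp.toLp 2 v)
  rw [EuclideanSpace.inner_eq_star_dotProduct, dotProduct_comm] at h
  rw [h, sqNorm]
  push_cast
  rfl

/-! ### The quadratic form of the matrix inequality -/

section System

variable {n m p : ℕ} (A : Matrix (Fin n) (Fin n) ℂ) (B : Matrix (Fin n) (Fin m) ℂ)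
  (C : Matrix (Fin p) (Fin n) ℂ) (D : Matrix (Fin p) (Fin m) ℂ)

lemma lmiMatrix_quadraticForm (P : Matrix (Fin n) (Fin n) ℂ) (x : Fin n → ℂ) (u : Fin m → ℂ) :
    star (Sum.elim x u) ⬝ᵥ lmiMatrix A B C D P *ᵥ Sum.elim x u =
      star (A *ᵥ x + B *ᵥ u) ⬝ᵥ P *ᵥ (A *ᵥ x + B *ᵥ u) - star x ⬝ᵥ P *ᵥ x
        + sqNorm (C *ᵥ x + D *ᵥ u) - sqNorm u := by
  have hstar : star (Sum.elim x u) = Sum.elim (star x) (star u) := by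
    ext i; cases i <;> rfl
  rw [ofReal_sqNorm, ofReal_sqNorm, hstar, lmiMatrix, Matrix.add_mulVec, Matrix.fromBlocks_mulVec,
    Matrix.fromBlocks_mulVec, dotProduct_add]
  simp only [Sum.elim_comp_inl, Sum.elim_comp_inr, sumElim_dotProduct_sumElim]
  simp only [Matrix.sub_mulVec, Matrix.mulVec_add, star_add, Matrix.star_mulVec, dotProduct_add,
    add_dotProduct, dotProduct_sub, Matrix.one_mulVec, ← Matrix.mulVec_mulVec,
    Matrix.dotProduct_mulVec, Matrix.add_vecMul]
  ring

lemma lmiMatrix_isHermitian {P : Matrix (Fin n) (Fin n) ℂ} (hP : P.IsHermitian) :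
    (lmiMatrix A B C D P).IsHermitian := by
  refine Matrix.IsHermitian.add (.fromBlocks ?_ ?_ ?_) (.fromBlocks ?_ ?_ ?_) <;>
    simp [Matrix.IsHermitian, Matrix.conjTranspose_mul, hP.eq, Matrix.mul_assoc]

/-- The matrix inequality is the dissipation inequality for the storage function `x ↦ x* P x` and
the supply rate `‖w‖² - ‖z‖²`. -/
lemma neg_lmiMatrix_posSemidef_iff {P : Matrix (Fin n) (Fin n) ℂ} (hP : P.IsHermitian)
    {S : (Fin n → ℂ) → ℝ} (hS : ∀ x, star x ⬝ᵥ P *ᵥ x = S x) :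
    (-(lmiMatrix A B C D P)).PosSemidef ↔ ∀ x u,
      sqNorm (C *ᵥ x + D *ᵥ u) - sqNorm u + S (A *ᵥ x + B *ᵥ u) ≤ S x := by
  have key : ∀ x u, 0 ≤ star (Sum.elim x u) ⬝ᵥ (-(lmiMatrix A B C D P)) *ᵥ Sum.elim x u ↔
      sqNorm (C *ᵥ x + D *ᵥ u) - sqNorm u + S (A *ᵥ x + B *ᵥ u) ≤ S x := by
    intro x u
    rw [Matrix.neg_mulVec, dotProduct_neg, lmiMatrix_quadraticForm, hS, hS, neg_nonneg]
    norm_cast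
    constructor <;> intro h <;> linarith
  rw [Matrix.posSemidef_iff_dotProduct_mulVec]
  constructor
  · exact fun h x u => (key x u).mp (h.2 _)
  · refine fun h => ⟨(lmiMatrix_isHermitian A B C D hP).neg, fun v => ?_⟩
    rw [← Sum.elim_comp_inl_inr v]
    exact (key _ _).mpr (h _ _)

end System

/-! ### Trajectories over a finite horizon -/

section System

variable {n m p : ℕ} (A : Matrix (Fin n) (Fin n) ℂ) (B : Matrix (Fin n) (Fin m) ℂ)
  (C : Matrix (Fin p) (Fin n) ℂ) (D : Matrix (Fin p) (Fin m) ℂ)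

/-- The state at each time, for the initial state `x` and the disturbance `w`. -/
def stateAt (x : Fin n → ℂ) (w : ℕ → Fin m → ℂ) : ℕ → Fin n → ℂ
  | 0 => x
  | k + 1 => A *ᵥ stateAt x w k + B *ᵥ w k

/-- The output energy minus the disturbance energy over the first `N` steps, starting at `x`. -/
noncomputable def gain (N : ℕ) (x : Fin n → ℂ) (w : ℕ → Fin m → ℂ) : ℝ :=
  ∑ k ∈ Finset.range N, (sqNorm (C *ᵥ stateAt A B x w k + D *ᵥ w k) - sqNorm (w k))

lemma stateAt_succ (x : Fin n → ℂ) (w : ℕ → Fin m → ℂ) (k : ℕ) :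
    stateAt A B x w (k + 1) = A *ᵥ stateAt A B x w k + B *ᵥ w k := rfl

lemma stateAt_add (x y : Fin n → ℂ) (u v : ℕ → Fin m → ℂ) (k : ℕ) :
    stateAt A B (x + y) (u + v) k = stateAt A B x u k + stateAt A B y v k := by
  induction k with
  | zero => rfl
  | succ k ih =>
    simp only [stateAt_succ, ih, Pi.add_apply, Matrix.mulVec_add]
    abel

lemma stateAt_smul (c : ℂ) (x : Fin n → ℂ) (w : ℕ → Fin m → ℂ) (k : ℕ) :
    stateAt A B (c • x) (c • w) k = c • stateAt A B x w k := by
  induction k with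
  | zero => rfl
  | succ k ih => simp only [stateAt_succ, ih, Pi.smul_apply, Matrix.mulVec_smul, smul_add]

lemma stateAt_sub (x y : Fin n → ℂ) (u v : ℕ → Fin m → ℂ) (k : ℕ) :
    stateAt A B (x - y) (u - v) k = stateAt A B x u k - stateAt A B y v k := by
  rw [eq_sub_iff_add_eq, ← stateAt_add, sub_add_cancel, sub_add_cancel]

lemma stateAt_congr (x : Fin n → ℂ) {u v : ℕ → Fin m → ℂ} {N : ℕ} (h : ∀ k < N, u k = v k)
    {k : ℕ} (hk : k ≤ N) : stateAt A B x u k = stateAt A B x v k := by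
  induction k with
  | zero => rfl
  | succ k ih => rw [stateAt_succ, stateAt_succ, ih (by omega), h k (by omega)]

lemma stateAt_shift (x : Fin n → ℂ) (w : ℕ → Fin m → ℂ) (N k : ℕ) :
    stateAt A B x w (N + k) = stateAt A B (stateAt A B x w N) (fun j => w (N + j)) k := by
  induction k with
  | zero => rfl
  | succ k ih => rw [← add_assoc, stateAt_succ, stateAt_succ, ih]

lemma stateAt_eq_sum (w : ℕ → Fin m → ℂ) (N : ℕ) :
    stateAt A B 0 w N = ∑ k ∈ Finset.range N, (A ^ k * B) *ᵥ w (N - 1 - k) := by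
  induction N with
  | zero => rfl
  | succ N ih =>
    rw [stateAt_succ, ih, Finset.sum_range_succ', Matrix.mulVec_sum]
    congr 1
    · refine Finset.sum_congr rfl fun k _ => ?_
      rw [Matrix.mulVec_mulVec, ← Matrix.mul_assoc, ← pow_succ',
        show N + 1 - 1 - (k + 1) = N - 1 - k by omega]
    · simp

lemma gain_congr (x : Fin n → ℂ) {u v : ℕ → Fin m → ℂ} {N : ℕ} (h : ∀ k < N, u k = v k) :
    gain A B C D N x u = gain A B C D N x v := by
  refine Finset.sum_congr rfl fun k hk => ?_
  have hk := Finset.mem_range.mp hk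
  rw [stateAt_congr A B x h hk.le, h k hk]

lemma gain_add_horizon (N M : ℕ) (x : Fin n → ℂ) (w : ℕ → Fin m → ℂ) :
    gain A B C D (N + M) x w =
      gain A B C D N x w + gain A B C D M (stateAt A B x w N) (fun k => w (N + k)) := by
  simp only [gain, Finset.sum_range_add, stateAt_shift]

lemma gain_smul (c : ℂ) (N : ℕ) (x : Fin n → ℂ) (w : ℕ → Fin m → ℂ) :
    gain A B C D N (c • x) (c • w) = ‖c‖ ^ 2 * gain A B C D N x w := by
  simp only [gain, Finset.mul_sum, stateAt_smul, Pi.smul_apply, Matrix.mulVec_smul, ← smul_add,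
    sqNorm_smul, mul_sub]

lemma gain_parallelogram (N : ℕ) (x y : Fin n → ℂ) (u v : ℕ → Fin m → ℂ) :
    gain A B C D N (x + y) (u + v) + gain A B C D N (x - y) (u - v) =
      2 * (gain A B C D N x u + gain A B C D N y v) := by
  simp only [gain, ← Finset.sum_add_distrib, Finset.mul_sum]
  refine Finset.sum_congr rfl fun k _ => ?_
  have h₁ := sqNorm_parallelogram (C *ᵥ stateAt A B x u k + D *ᵥ u k)
    (C *ᵥ stateAt A B y v k + D *ᵥ v k)
  have h₂ := sqNorm_parallelogram (u k) (v k)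
  rw [add_add_add_comm, ← Matrix.mulVec_add, ← Matrix.mulVec_add, add_sub_add_comm,
    ← Matrix.mulVec_sub, ← Matrix.mulVec_sub] at h₁
  simp only [stateAt_add, stateAt_sub, Pi.add_apply, Pi.sub_apply]
  linarith

lemma gain_zero_disturbance_nonneg (N : ℕ) (x : Fin n → ℂ) : 0 ≤ gain A B C D N x 0 := by
  refine Finset.sum_nonneg fun k _ => ?_
  simpa using sqNorm_nonneg _

lemma exists_gain_le_succ (N : ℕ) (x : Fin n → ℂ) (w : ℕ → Fin m → ℂ) :
    ∃ w', gain A B C D N x w ≤ gain A B C D (N + 1) x w' := by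
  refine ⟨fun k => if k < N then w k else 0, ?_⟩
  have h : gain A B C D N x w = gain A B C D N x fun k => if k < N then w k else 0 :=
    gain_congr A B C D x fun k hk => (if_pos hk).symm
  rw [gain_add_horizon, h, le_add_iff_nonneg_right]
  simpa [gain] using sqNorm_nonneg _

/-- If the storage function `S` dissipates at the supply rate `‖w‖² - ‖z‖²`, the gain is at most
the drop in storage. -/
lemma gain_le_of_dissipation {S : (Fin n → ℂ) → ℝ}
    (hS : ∀ x u, sqNorm (C *ᵥ x + D *ᵥ u) - sqNorm u + S (A *ᵥ x + B *ᵥ u) ≤ S x)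
    (N : ℕ) (x : Fin n → ℂ) (w : ℕ → Fin m → ℂ) :
    gain A B C D N x w ≤ S x - S (stateAt A B x w N) := by
  induction N with
  | zero => simp [gain, stateAt]
  | succ N ih =>
    have h := hS (stateAt A B x w N) (w N)
    rw [← stateAt_succ] at h
    rw [gain, Finset.sum_range_succ, ← gain]
    linarith

/-- A storage function of a Schur stable system is nonnegative: it decreases along the undisturbed
trajectories, which tend to `0`. -/
lemma storage_nonneg_of_dissipation (hA : spectralRadius ℂ A < 1) {S : (Fin n → ℂ) → ℝ}
    (hcont : Continuous S) (h₀ : S 0 = 0)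
    (hS : ∀ x u, sqNorm (C *ᵥ x + D *ᵥ u) - sqNorm u + S (A *ᵥ x + B *ᵥ u) ≤ S x)
    (x : Fin n → ℂ) : 0 ≤ S x := by
  have hlim : Tendsto (fun k : ℕ => S ((A ^ k) *ᵥ x)) atTop (𝓝 0) := by
    have h := (hcont.tendsto 0).comp (tendsto_pow_mulVec_zero hA x)
    rwa [h₀] at h
  refine le_of_tendsto' hlim fun k => ?_
  induction k with
  | zero => simp
  | succ k ih =>
    have h := hS ((A ^ k) *ᵥ x) 0
    rw [Matrix.mulVec_zero, Matrix.mulVec_zero, add_zero, add_zero, sqNorm_zero, sub_zero,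
      Matrix.mulVec_mulVec (N := A ^ k) (M := A), ← pow_succ'] at h
    linarith [sqNorm_nonneg (C *ᵥ (A ^ k) *ᵥ x)]

/-! ### The available storage -/

/-- The available storage over the horizon `N`: the largest gain that a disturbance can extract
from the initial state `x`. This is a supremum of reals, so it is meaningful only when the gain is
bounded above. -/
noncomputable def finiteStorage (N : ℕ) (x : Fin n → ℂ) : ℝ := ⨆ w, gain A B C D N x w

/-- The available storage over all finite horizons. -/
noncomputable def availableStorage (x : Fin n → ℂ) : ℝ := ⨆ N, finiteStorage A B C D N x

variable {A B C D}

lemma gain_le_finiteStorage (hbdd : ∀ x, ∃ c, ∀ N w, gain A B C D N x w ≤ c)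
    (N : ℕ) (x : Fin n → ℂ) (w : ℕ → Fin m → ℂ) :
    gain A B C D N x w ≤ finiteStorage A B C D N x := by
  obtain ⟨c, hc⟩ := hbdd x
  exact le_ciSup (f := gain A B C D N x) ⟨c, by rintro _ ⟨w, rfl⟩; exact hc N w⟩ w

lemma finiteStorage_nonneg (hbdd : ∀ x, ∃ c, ∀ N w, gain A B C D N x w ≤ c)
    (N : ℕ) (x : Fin n → ℂ) : 0 ≤ finiteStorage A B C D N x :=
  (gain_zero_disturbance_nonneg A B C D N x).trans (gain_le_finiteStorage hbdd N x 0)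

lemma finiteStorage_mono (hbdd : ∀ x, ∃ c, ∀ N w, gain A B C D N x w ≤ c) (x : Fin n → ℂ) :
    Monotone fun N => finiteStorage A B C D N x := by
  refine monotone_nat_of_le_succ fun N => ciSup_le fun w => ?_
  obtain ⟨w', hw'⟩ := exists_gain_le_succ A B C D N x w
  exact hw'.trans (gain_le_finiteStorage hbdd _ x w')

lemma tendsto_finiteStorage (hbdd : ∀ x, ∃ c, ∀ N w, gain A B C D N x w ≤ c) (x : Fin n → ℂ) :
    Tendsto (fun N => finiteStorage A B C D N x) atTop (𝓝 (availableStorage A B C D x)) := by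
  obtain ⟨c, hc⟩ := hbdd x
  exact tendsto_atTop_ciSup (finiteStorage_mono hbdd x)
    ⟨c, by rintro _ ⟨N, rfl⟩; exact ciSup_le (hc N)⟩

/-- The pairs `(u + v, u - v)` exhaust all pairs of disturbances, so the parallelogram law of the
gain in the pair `(x, w)` survives the supremum over `w`. -/
lemma finiteStorage_parallelogram (hbdd : ∀ x, ∃ c, ∀ N w, gain A B C D N x w ≤ c)
    (N : ℕ) (x y : Fin n → ℂ) :
    finiteStorage A B C D N (x + y) + finiteStorage A B C D N (x - y) =
      2 * (finiteStorage A B C D N x + finiteStorage A B C D N y) := by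
  apply le_antisymm
  · refine ciSup_add_ciSup_le fun u v => ?_
    have h := gain_parallelogram A B C D N x y ((2⁻¹ : ℂ) • (u + v)) ((2⁻¹ : ℂ) • (u - v))
    have h₁ : (2⁻¹ : ℂ) • (u + v) + (2⁻¹ : ℂ) • (u - v) = u := by module
    have h₂ : (2⁻¹ : ℂ) • (u + v) - (2⁻¹ : ℂ) • (u - v) = v := by module
    rw [h₁, h₂] at h
    rw [h]
    gcongr <;> exact gain_le_finiteStorage hbdd N _ _
  · rw [← le_div_iff₀' two_pos]
    refine ciSup_add_ciSup_le fun u v => ?_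
    rw [le_div_iff₀' two_pos, ← gain_parallelogram]
    gcongr <;> exact gain_le_finiteStorage hbdd N _ _

lemma finiteStorage_smul (hbdd : ∀ x, ∃ c, ∀ N w, gain A B C D N x w ≤ c)
    (N : ℕ) (c : ℂ) (x : Fin n → ℂ) :
    finiteStorage A B C D N (c • x) = ‖c‖ ^ 2 * finiteStorage A B C D N x := by
  rcases eq_or_ne c 0 with rfl | hc
  · have h := finiteStorage_parallelogram hbdd N 0 0
    rw [add_zero, sub_zero] at h
    rw [zero_smul, norm_zero]
    linarith
  · rw [finiteStorage, finiteStorage, Real.mul_iSup_of_nonneg (sq_nonneg _)]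
    simp only [← gain_smul]
    -- Scaling by `c` permutes the disturbances.
    exact ((MulAction.surjective₀ hc).iSup_comp (fun w => gain A B C D N (c • x) w)).symm

lemma availableStorage_nonneg (hbdd : ∀ x, ∃ c, ∀ N w, gain A B C D N x w ≤ c)
    (x : Fin n → ℂ) : 0 ≤ availableStorage A B C D x :=
  ge_of_tendsto' (tendsto_finiteStorage hbdd x) fun N => finiteStorage_nonneg hbdd N x

lemma availableStorage_parallelogram (hbdd : ∀ x, ∃ c, ∀ N w, gain A B C D N x w ≤ c)
    (x y : Fin n → ℂ) :
    availableStorage A B C D (x + y) + availableStorage A B C D (x - y) =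
      2 * (availableStorage A B C D x + availableStorage A B C D y) := by
  refine tendsto_nhds_unique
    ((tendsto_finiteStorage hbdd (x + y)).add (tendsto_finiteStorage hbdd (x - y))) ?_
  simp only [finiteStorage_parallelogram hbdd]
  exact ((tendsto_finiteStorage hbdd x).add (tendsto_finiteStorage hbdd y)).const_mul 2

lemma availableStorage_smul (hbdd : ∀ x, ∃ c, ∀ N w, gain A B C D N x w ≤ c)
    (c : ℂ) (x : Fin n → ℂ) :
    availableStorage A B C D (c • x) = ‖c‖ ^ 2 * availableStorage A B C D x := by
  refine tendsto_nhds_unique (tendsto_finiteStorage hbdd (c • x)) ?_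
  simp only [finiteStorage_smul hbdd]
  exact (tendsto_finiteStorage hbdd x).const_mul _

/-- Applying `u` first and then an almost optimal disturbance is one way to extract energy. -/
lemma availableStorage_dissipation (hbdd : ∀ x, ∃ c, ∀ N w, gain A B C D N x w ≤ c)
    (x : Fin n → ℂ) (u : Fin m → ℂ) :
    sqNorm (C *ᵥ x + D *ᵥ u) - sqNorm u + availableStorage A B C D (A *ᵥ x + B *ᵥ u) ≤
      availableStorage A B C D x := by
  rw [← le_sub_iff_add_le']
  refine ciSup_le fun N => ciSup_le fun w => ?_
  rw [le_sub_iff_add_le']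
  let w' : ℕ → Fin m → ℂ := fun k => Nat.casesOn k u w
  have h : gain A B C D (1 + N) x w' =
      sqNorm (C *ᵥ x + D *ᵥ u) - sqNorm u + gain A B C D N (A *ᵥ x + B *ᵥ u) w := by
    rw [gain_add_horizon]
    have hw : (fun k => w' (1 + k)) = w := by
      funext k
      rw [add_comm]
    rw [hw]
    simp [gain, w', stateAt]
  rw [← h]
  exact (gain_le_finiteStorage hbdd _ x w').trans
    ((finiteStorage_mono hbdd x).ge_of_tendsto (tendsto_finiteStorage hbdd x) _)

end System

section System

variable {n m p : ℕ} {A : Matrix (Fin n) (Fin n) ℂ} {B : Matrix (Fin n) (Fin m) ℂ}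
  {C : Matrix (Fin p) (Fin n) ℂ} {D : Matrix (Fin p) (Fin m) ℂ}

/-! ### Reachability -/

lemma IsControllable.exists_stateAt_eq (hAB : IsControllable A B) (x : Fin n → ℂ) :
    ∃ w, stateAt A B 0 w n = x := by
  have hrange : LinearMap.range (controllabilityMatrix A B).mulVecLin = ⊤ := by
    apply Submodule.eq_top_of_finrank_eq
    rw [Module.finrank_fin_fun]
    exact hAB
  obtain ⟨c, hc⟩ := LinearMap.range_eq_top.mp hrange x
  -- Block `k` of the coefficient vector acts `k` steps before the final time.
  refine ⟨fun k j => if h : n - 1 - k < n then c (⟨n - 1 - k, h⟩, j) else 0, ?_⟩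
  rw [stateAt_eq_sum, ← hc, ← Fin.sum_univ_eq_sum_range
    (fun k => (A ^ k * B) *ᵥ fun j =>
      if h : n - 1 - (n - 1 - k) < n then c (⟨n - 1 - (n - 1 - k), h⟩, j) else 0)]
  ext i
  rw [Matrix.mulVecLin_apply, Finset.sum_apply, Matrix.mulVec, dotProduct, Fintype.sum_prod_type]
  refine Finset.sum_congr rfl fun k _ => ?_
  rw [Matrix.mulVec, dotProduct]
  refine Finset.sum_congr rfl fun j _ => ?_
  have hk : n - 1 - (n - 1 - (k : ℕ)) = k := by omega
  simp [controllabilityMatrix, hk]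

/-- If no disturbance has positive gain from the origin, the gain from any reachable state is at
most the cost of reaching it. -/
lemma exists_gain_bound (hAB : IsControllable A B) (h₀ : ∀ N w, gain A B C D N 0 w ≤ 0)
    (x : Fin n → ℂ) : ∃ c, ∀ N w, gain A B C D N x w ≤ c := by
  obtain ⟨v, hv⟩ := hAB.exists_stateAt_eq x
  refine ⟨-gain A B C D n 0 v, fun N w => ?_⟩
  let u : ℕ → Fin m → ℂ := fun k => if k < n then v k else w (k - n)
  have huv : ∀ k < n, u k = v k := fun k hk => if_pos hk
  have huw : (fun k => u (n + k)) = w := by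
    funext k
    simp [u]
  have h := h₀ (n + N) u
  rw [gain_add_horizon, gain_congr A B C D 0 huv, stateAt_congr A B 0 huv le_rfl, hv, huw] at h
  linarith

/-! ### Square summable disturbances -/

lemma IsTrajectory.ofLp_state {w : Signal m} {x : ℕ → EuclideanSpace ℂ (Fin n)}
    {z : ℕ → EuclideanSpace ℂ (Fin p)} (h : IsTrajectory A B C D w x z) (k : ℕ) :
    (x k).ofLp = stateAt A B 0 (fun j => (w j).ofLp) k := by
  induction k with
  | zero => rw [h.initial]; rfl
  | succ k ih => rw [h.state, ih, stateAt_succ]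

lemma IsTrajectory.gain_eq {w : Signal m} {x : ℕ → EuclideanSpace ℂ (Fin n)}
    {z : ℕ → EuclideanSpace ℂ (Fin p)} (h : IsTrajectory A B C D w x z) (N : ℕ) :
    gain A B C D N 0 (fun j => (w j).ofLp) =
      ∑ k ∈ Finset.range N, ‖z k‖ ^ 2 - ∑ k ∈ Finset.range N, ‖w k‖ ^ 2 := by
  rw [← Finset.sum_sub_distrib]
  refine Finset.sum_congr rfl fun k _ => ?_
  rw [h.output, h.ofLp_state]
  rfl

variable (A B C D) in
lemma isTrajectory_stateAt (w : Signal m) :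
    IsTrajectory A B C D w
      (fun k => WithLp.toLp 2 (stateAt A B 0 (fun j => (w j).ofLp) k))
      (fun k => WithLp.toLp 2
        (C *ᵥ stateAt A B 0 (fun j => (w j).ofLp) k + D *ᵥ (w k).ofLp)) where
  initial := rfl
  state _ := rfl
  output _ := rfl

lemma sum_range_norm_sq_le (w : Signal m) (N : ℕ) :
    ∑ k ∈ Finset.range N, ‖w k‖ ^ 2 ≤ ‖w‖ ^ 2 := by
  have h := lp.sum_rpow_le_norm_rpow (p := 2) (by norm_num) w (Finset.range N)
  simpa using h

lemma sum_enorm_sq_eq_ofReal {k : ℕ} (z : ℕ → EuclideanSpace ℂ (Fin k)) (N : ℕ) :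
    ∑ j ∈ Finset.range N, ‖z j‖ₑ ^ 2 = ENNReal.ofReal (∑ j ∈ Finset.range N, ‖z j‖ ^ 2) := by
  rw [ENNReal.ofReal_sum_of_nonneg fun j _ => sq_nonneg _]
  simp [ENNReal.ofReal_pow]

lemma muInf_le_one_of_gain_nonpos (h₀ : ∀ N w, gain A B C D N 0 w ≤ 0) :
    muInf A B C D ≤ 1 := by
  refine sSup_le ?_
  rintro _ ⟨w, x, z, h, hw, rfl⟩
  refine ENNReal.tsum_le_of_sum_range_le fun N => ?_
  have hN := h₀ N fun j => (w j).ofLp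
  rw [h.gain_eq] at hN
  have hz : ∑ k ∈ Finset.range N, ‖z k‖ ^ 2 ≤ 1 := by
    linarith [sum_range_norm_sq_le w N]
  rw [sum_enorm_sq_eq_ofReal]
  exact ENNReal.ofReal_le_one.mpr hz

/-- Truncating a disturbance at the horizon and normalizing it gives an admissible one. -/
lemma gain_nonpos_of_muInf_le_one (hmu : muInf A B C D ≤ 1) (N : ℕ) (w : ℕ → Fin m → ℂ) :
    gain A B C D N 0 w ≤ 0 := by
  let f : ℕ → EuclideanSpace ℂ (Fin m) := fun k => if k < N then WithLp.toLp 2 (w k) else 0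
  have hf : Memℓp f 2 := by
    refine memℓp_gen (summable_of_ne_finset_zero (s := Finset.range N) fun k hk => ?_)
    rw [Finset.mem_range] at hk
    simp [f, hk]
  let u : Signal m := ⟨f, hf⟩
  have hu : ∀ k < N, (u k).ofLp = w k := fun k hk => by
    change (f k).ofLp = w k
    simp [f, hk]
  have hunorm : ‖u‖ ^ 2 = ∑ k ∈ Finset.range N, ‖u k‖ ^ 2 := by
    have h := lp.norm_rpow_eq_tsum (p := 2) (by norm_num) u
    rw [tsum_eq_sum (s := Finset.range N)] at h
    · simpa using h
    · intro k hk
      rw [Finset.mem_range] at hk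
      have : u k = 0 := if_neg hk
      simp [this]
  rw [← gain_congr A B C D 0 hu]
  rcases eq_or_ne u 0 with h0 | h0
  · have hz : (fun j => (u j).ofLp) = (0 : ℂ) • fun j => (u j).ofLp := by
      rw [h0]
      funext j
      simp
    rw [hz, ← smul_zero (0 : ℂ), gain_smul]
    simp
  · have hnorm : ‖u‖ ≠ 0 := norm_ne_zero_iff.mpr h0
    let c : ℂ := (‖u‖⁻¹ : ℝ)
    have hc : ‖c‖ = ‖u‖⁻¹ := by simp [c]
    have htraj := isTrajectory_stateAt A B C D (c • u)
    set z : ℕ → EuclideanSpace ℂ (Fin p) := fun k => WithLp.toLp 2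
        (C *ᵥ stateAt A B 0 (fun j => ((c • u) j).ofLp) k + D *ᵥ ((c • u) k).ofLp)
    have hone : ‖c • u‖ ^ 2 = 1 := by
      rw [norm_smul, hc, inv_mul_cancel₀ hnorm, one_pow]
    have henergy : energy z ≤ 1 := by
      refine le_trans (le_sSup ?_) hmu
      exact ⟨_, _, z, htraj, hone, rfl⟩
    have hz : ∑ k ∈ Finset.range N, ‖z k‖ ^ 2 ≤ 1 := by
      have h := (ENNReal.sum_le_tsum (Finset.range N)).trans henergy
      rw [sum_enorm_sq_eq_ofReal] at h
      exact ENNReal.ofReal_le_one.mp h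
    have hsum : ∑ k ∈ Finset.range N, ‖(c • u) k‖ ^ 2 = 1 := by
      rw [← hone, norm_smul, mul_pow, hunorm, Finset.mul_sum]
      refine Finset.sum_congr rfl fun k _ => ?_
      rw [lp.coeFn_smul, Pi.smul_apply, norm_smul, mul_pow]
    have hgain := htraj.gain_eq N
    have hscale : gain A B C D N 0 (fun j => ((c • u) j).ofLp)
        = ‖c‖ ^ 2 * gain A B C D N 0 (fun j => (u j).ofLp) := by
      rw [← gain_smul, smul_zero]
      rfl
    rw [hscale, hsum] at hgain
    have hcpos : 0 < ‖c‖ ^ 2 := by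
      rw [hc]
      positivity
    refine nonpos_of_mul_nonpos_right ?_ hcpos
    linarith

end System

end KYP

/-! ### Equivalence of the energy bound and the matrix inequality -/

theorem mainTheorem4 {n m p : ℕ} (A : Matrix (Fin n) (Fin n) ℂ) (B : Matrix (Fin n) (Fin m) ℂ)
    (C : Matrix (Fin p) (Fin n) ℂ) (D : Matrix (Fin p) (Fin m) ℂ)
    (hA : spectralRadius ℂ A < 1) (hAB : KYP.IsControllable A B) :
    KYP.muInf A B C D ≤ 1 ↔
      ∃ P : Matrix (Fin n) (Fin n) ℂ, P.IsHermitian ∧ (-(KYP.lmiMatrix A B C D P)).PosSemidef := by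
  constructor
  · intro hmu
    have hbdd := KYP.exists_gain_bound hAB (KYP.gain_nonpos_of_muInf_le_one hmu)
    obtain ⟨P, hP, hPS⟩ := KYP.exists_isHermitian_of_parallelogram
      (KYP.availableStorage_smul hbdd) (KYP.availableStorage_parallelogram hbdd)
      (KYP.availableStorage_nonneg hbdd)
    exact ⟨P, hP, (KYP.neg_lmiMatrix_posSemidef_iff A B C D hP hPS).mpr
      (KYP.availableStorage_dissipation hbdd)⟩
  · rintro ⟨P, hP, hlmi⟩
    let S : (Fin n → ℂ) → ℝ := fun x => (star x ⬝ᵥ P *ᵥ x).re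
    have hPS : ∀ x, star x ⬝ᵥ P *ᵥ x = S x := fun x =>
      (Complex.conj_eq_iff_re.mp (by
        rw [starRingEnd_apply, ← Matrix.star_dotProduct, Matrix.star_mulVec, hP.eq,
          ← Matrix.dotProduct_mulVec])).symm
    have hdiss := (KYP.neg_lmiMatrix_posSemidef_iff A B C D hP hPS).mp hlmi
    have hcont : Continuous S := Complex.continuous_re.comp
      (continuous_star.dotProduct (continuous_const.matrix_mulVec continuous_id))
    have h₀ : S 0 = 0 := by simp [S]
    refine KYP.muInf_le_one_of_gain_nonpos fun N w => ?_
    have h := KYP.gain_le_of_dissipation A B C D hdiss N 0 w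
    have hnn := KYP.storage_nonneg_of_dissipation A B C D hA hcont h₀ hdiss
      (KYP.stateAt A B 0 w N)
    linarith
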